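/- All graphs are finite, simple and undirected. An edge-ordered graph $G^{\prec}$ is a graph $G$ together with a linear order $\prec$ on its edge set $E(G)$. An edge-ordered copy of $G^{\prec}$ in an edge-ordered graph $F^{\prec}$ is given by an injective map $V(G)\to V(F)$ that sends edges to edges and whose induced map $E(G)\to E(F)$ preserves the edge orders. The size edge-ordered Ramsey number $\hat r_{\mathrm{edge}}(G^{\prec})$ is the smallest $m$ for which there is an edge-ordered graph $F^{\prec}$ with $m$ edges such that every colouring of the edges of $F$ with two colours contains an edge-ordered copy of $G^{\prec}$ all of whose edges have the same colour. Let $K_{s,t}^{\prec}$ be the complete bipartite graph with parts $\{u_1,\dots,u_s\}$ and $\{v_1,\dots,v_t\}$ whose edges are ordered lexicographically: $u_iv_j\prec u_kv_l$ if and only if $i<k$, or $i=k$ and $j<l$. Then, for fixed $s$ and sufficiently large $t$, $\hat r_{\mathrm{edge}}(K_{s,t}^{\prec})=\Theta(s^2 2^s t)$, with implied constants that do not depend on $s$ or $t$. That is, there are absolute constants $c, C>0$ such that for every integer $s\ge 1$ there is an integer $t_0=t_0(s)$ such that for all integers $t\ge t_0$ $$c\, s^2 2^s t\;\le\;\hat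 r_{\mathrm{edge}}(K_{s,t}^{\prec})\;\le\; C\, s^2 2^s t .$$ -/

import Mathlib

/-- An edge-ordered graph on the vertex set `V`: a simple graph together with a (strict) linear
ordering of its edge set. -/
structure EdgeOrderedGraph (V : Type*) where
  graph : SimpleGraph V
  lt : graph.edgeSet → graph.edgeSet → Prop
  isStrictTotalOrder : IsStrictTotalOrder graph.edgeSet lt

namespace EdgeOrderedGraph

/-- `F.HasCopy χ b G`: in the edge-coloring `χ` of `F` there is an edge-ordered copy of `G` all of
whose edges have the color `b`. The copy is an injective homomorphism of the underlying graphs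
(an isomorphism onto a not necessarily induced subgraph) whose edge map preserves the order. -/
def HasCopy {V W : Type*} (F : EdgeOrderedGraph W) (χ : F.graph.edgeSet → Bool) (b : Bool)
    (G : EdgeOrderedGraph V) : Prop :=
  ∃ φ : SimpleGraph.Copy G.graph F.graph,
    (∀ e f : G.graph.edgeSet, G.lt e f ↔ F.lt (φ.mapEdgeSet e) (φ.mapEdgeSet f)) ∧
    ∀ e : G.graph.edgeSet, χ (φ.mapEdgeSet e) = b

/-- `F → (G, H)`: every coloring of the edges of `F` with two colors (`true` is red, `false` is
blue) has a red edge-ordered copy of `G` or a blue edge-ordered copy of `H`. -/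
def Arrows {V V' W : Type*} (F : EdgeOrderedGraph W) (G : EdgeOrderedGraph V)
    (H : EdgeOrderedGraph V') : Prop :=
  ∀ χ : F.graph.edgeSet → Bool, F.HasCopy χ true G ∨ F.HasCopy χ false H

/-- The size edge-ordered Ramsey number of `G` and `H`: the smallest number of edges of a finite
edge-ordered graph `F` with `F → (G, H)`. -/
noncomputable def sizeRamsey {V V' : Type*} (G : EdgeOrderedGraph V) (H : EdgeOrderedGraph V') :
    ℕ :=
  sInf {m : ℕ | ∃ (n : ℕ) (F : EdgeOrderedGraph (Fin n)), F.graph.edgeSet.ncard = m ∧ F.Arrows G H}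

/-- The lexicographic order of the edges of the complete bipartite graph with parts
`u_i` (`i : Fin s`) and `v_j` (`j : Fin t`):
`u_i v_j` precedes `u_k v_l` iff `i < k`, or `i = k` and `j < l`. -/
def bipartiteLexLT (s t : ℕ) (e f : (completeBipartiteGraph (Fin s) (Fin t)).edgeSet) : Prop :=
  ∃ (i k : Fin s) (j l : Fin t),
    (e : Sym2 (Fin s ⊕ Fin t)) = s(Sum.inl i, Sum.inr j) ∧
    (f : Sym2 (Fin s ⊕ Fin t)) = s(Sum.inl k, Sum.inr l) ∧
    (i < k ∨ (i = k ∧ j < l))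

theorem exists_eq_of_mem_edgeSet_bipartite {s t : ℕ}
    (e : (completeBipartiteGraph (Fin s) (Fin t)).edgeSet) :
    ∃ (i : Fin s) (j : Fin t), (e : Sym2 (Fin s ⊕ Fin t)) = s(Sum.inl i, Sum.inr j) := by
  obtain ⟨e, he⟩ := e
  induction e using Sym2.ind with
  | _ x y =>
    rw [SimpleGraph.mem_edgeSet] at he
    rcases x with i | j <;> rcases y with i' | j'
    · simp at he
    · exact ⟨i, j', rfl⟩
    · exact ⟨i', j, Sym2.eq_swap⟩
    · simp at he

theorem bipartiteLexLT_isStrictTotalOrder (s t : ℕ) :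
    IsStrictTotalOrder (completeBipartiteGraph (Fin s) (Fin t)).edgeSet (bipartiteLexLT s t) where
  irrefl e := by
    rintro ⟨i, k, j, l, h1, h2, h⟩
    rw [h1] at h2
    simp at h2
    grind
  trans e f g := by
    rintro ⟨i, k, j, l, h1, h2, h⟩ ⟨i', k', j', l', h1', h2', h'⟩
    rw [h2] at h1'
    simp at h1'
    obtain ⟨rfl, rfl⟩ := h1'
    exact ⟨i, k', j, l', h1, h2', by grind⟩
  trichotomous e f := by
    intro h1 h2
    obtain ⟨i, j, he⟩ := exists_eq_of_mem_edgeSet_bipartite e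
    obtain ⟨k, l, hf⟩ := exists_eq_of_mem_edgeSet_bipartite f
    have h3 : ¬ (i < k ∨ (i = k ∧ j < l)) := fun h => h1 ⟨i, k, j, l, he, hf, h⟩
    have h4 : ¬ (k < i ∨ (k = i ∧ l < j)) := fun h => h2 ⟨k, i, l, j, hf, he, h⟩
    have h5 : i = k := by grind
    have h6 : j = l := by grind
    subst h5 h6
    exact Subtype.ext (he.trans hf.symm)

/-- The edge-ordered complete bipartite graph `K_{s,t}` with the lexicographic edge order. -/
def completeBipartite (s t : ℕ) : EdgeOrderedGraph (Fin s ⊕ Fin t) where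
  graph := completeBipartiteGraph (Fin s) (Fin t)
  lt := bipartiteLexLT s t
  isStrictTotalOrder := bipartiteLexLT_isStrictTotalOrder s t

end EdgeOrderedGraph

/-! Lower bound: the `s`-side of a copy consists of vertices of degree at least `t`. If there are `e
< s^2 2^s t / 64` edges, the set `A` of such vertices has size bounded in `s`. Each `v` outside `A`
has half of its edges to `A` coloured red, the rest blue. Exact halves beat independent colours: if
`v` has `n` neighbours in `A`, a fixed `s`-set among them lies in a half with probability about
`2^{-s} exp(-s^2/2n)`, at most `8n / (s^2 2^s)`. This is linear in `n`, so the sum over `v` is at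
most `16e / (s^2 2^s) < t/4`. Spreading the halves evenly over vertices with equal neighbourhoods in
`A` (`exists_balanced_halves`) makes this a count valid for every `S` at once, with a rounding error
depending only on `s`. The edge order plays no role.

Upper bound: in `K_{2s^2, 2^{s+2}t}` each right vertex has a majority colour on `s^2` left vertices,
hence on at least a `2^{-(s+1)}` fraction of the left `s`-sets. Double counting gives a
monochromatic `K_{s,t}` (`exists_mono_rectangle`), which inherits the lexicographic order. -/

/-! ### Binomial estimates -/

/-- The ratio `2^s (k)_s / (n)_s` is at most the product of `(n+1-2i)/(n-i) = 1 - (i-1)/(n-i)` over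
`i < s`. The factor `2n + (s-1)(s-2)` is a rational substitute for its exponential decay, chosen so
that the induction closes. -/
theorem two_pow_mul_descFactorial_le {n k s : ℕ} (hk : 2 * k ≤ n + 1) (hs : 1 ≤ s) (hsk : s ≤ k) :
    2 ^ s * (k.descFactorial s : ℝ) * (2 * n + ((s : ℝ) - 1) * (s - 2)) ≤
      4 * n * n.descFactorial s := by
  have hk' : 2 * (k : ℝ) ≤ n + 1 := by exact_mod_cast hk
  induction s, hs using Nat.le_induction with
  | base =>
    have h1 : (k : ℝ) ≤ n := by exact_mod_cast (by omega : k ≤ n)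
    simp only [Nat.descFactorial_one, Nat.cast_one]
    nlinarith [Nat.cast_nonneg (α := ℝ) n]
  | succ s hs ih =>
    have ih := ih (by omega)
    have hs1 : (1 : ℝ) ≤ s := by exact_mod_cast hs
    have hsk' : (s : ℝ) + 1 ≤ k := by exact_mod_cast hsk
    have hD : (0 : ℝ) ≤ 2 ^ s * (k.descFactorial s : ℝ) := by positivity
    rw [Nat.descFactorial_succ, Nat.descFactorial_succ, Nat.cast_mul, Nat.cast_mul,
      Nat.cast_sub (by omega), Nat.cast_sub (by omega)]
    push_cast
    have hM : (0 : ℝ) ≤ n - s := by linarith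
    have hq : 0 ≤ ((s : ℝ) - 1) * (s - 1) := mul_self_nonneg _
    have hpos : (0 : ℝ) ≤ 2 * n + ((s : ℝ) + 1 - 1) * (s + 1 - 2) := by nlinarith
    have key : 2 * ((k : ℝ) - s) * (2 * n + ((s : ℝ) + 1 - 1) * (s + 1 - 2)) ≤
        (n - s) * (2 * n + ((s : ℝ) - 1) * (s - 2)) := by
      calc 2 * ((k : ℝ) - s) * (2 * n + ((s : ℝ) + 1 - 1) * (s + 1 - 2))
          ≤ (n + 1 - 2 * s) * (2 * n + ((s : ℝ) + 1 - 1) * (s + 1 - 2)) :=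
            mul_le_mul_of_nonneg_right (by linarith) hpos
        _ ≤ _ := by
            have h3 : 0 ≤ ((s : ℝ) - 1) * (((s : ℝ) - 1) * s) := by
              apply mul_nonneg (by linarith) (mul_nonneg (by linarith) (by linarith))
            nlinarith
    calc _ = 2 ^ s * (k.descFactorial s : ℝ) *
          (2 * ((k : ℝ) - s) * (2 * n + ((s : ℝ) + 1 - 1) * (s + 1 - 2))) := by ring
      _ ≤ 2 ^ s * (k.descFactorial s : ℝ) * ((n - s) * (2 * n + ((s : ℝ) - 1) * (s - 2))) :=
          mul_le_mul_of_nonneg_left key hD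
      _ = (n - s) * (2 ^ s * (k.descFactorial s : ℝ) * (2 * n + ((s : ℝ) - 1) * (s - 2))) := by
          ring
      _ ≤ (n - s) * (4 * n * n.descFactorial s) := mul_le_mul_of_nonneg_left ih hM
      _ = _ := by ring

theorem sq_mul_two_pow_mul_choose_le {n k s : ℕ} (hk : 2 * k ≤ n + 1) (hs : 1 ≤ s) (hsk : s ≤ k) :
    (s : ℝ) ^ 2 * 2 ^ s * k.choose s ≤ 8 * n * n.choose s := by
  have h := two_pow_mul_descFactorial_le hk hs hsk
  rw [Nat.descFactorial_eq_factorial_mul_choose, Nat.descFactorial_eq_factorial_mul_choose] at h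
  push_cast at h
  have hf : (0 : ℝ) < s.factorial := by exact_mod_cast s.factorial_pos
  have hs1 : (1 : ℝ) ≤ s := by exact_mod_cast hs
  have hsn : (s : ℝ) ≤ n := by exact_mod_cast (by omega : s ≤ n)
  have h1 : (s : ℝ) ^ 2 ≤ 2 * (2 * n + ((s : ℝ) - 1) * (s - 2)) := by
    nlinarith [sq_nonneg ((s : ℝ) - 1)]
  have h2 : 2 ^ s * (k.choose s : ℝ) * (2 * n + ((s : ℝ) - 1) * (s - 2)) ≤ 4 * n * n.choose s := by
    refine le_of_mul_le_mul_left ?_ hf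
    linarith
  have h3 := mul_le_mul_of_nonneg_left h1 (by positivity : (0 : ℝ) ≤ 2 ^ s * (k.choose s : ℝ))
  linarith

theorem sq_mul_two_pow_mul_choose_sub_le {n k s : ℕ} (hk : 2 * k ≤ n + 1) (hs : 1 ≤ s)
    (hsk : s ≤ k) :
    (s : ℝ) ^ 2 * 2 ^ s * (n - s).choose (k - s) ≤ 8 * n * n.choose k := by
  have h := sq_mul_two_pow_mul_choose_le hk hs hsk
  have h1 : (n.choose k : ℝ) * k.choose s = n.choose s * (n - s).choose (k - s) := by
    exact_mod_cast Nat.choose_mul hsk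
  have h2 : (0 : ℝ) < n.choose s := by exact_mod_cast Nat.choose_pos (by omega)
  refine le_of_mul_le_mul_left ?_ h2
  calc _ = (s : ℝ) ^ 2 * 2 ^ s * (n.choose s * (n - s).choose (k - s)) := by ring
    _ = n.choose k * ((s : ℝ) ^ 2 * 2 ^ s * k.choose s) := by rw [← h1]; ring
    _ ≤ n.choose k * (8 * n * n.choose s) := by gcongr
    _ = _ := by ring

/-- Weierstrass' product inequality: the product of `1 - i/(2s^2-i)` over `i < r` is at least `1 -
r(r-1)/(2s^2)`, because `i/(2s^2-i) ≤ i/s^2`. At `r = s` this exceeds `1/2`. -/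
theorem descFactorial_two_mul_sq_le {s r : ℕ} (hs : 1 ≤ s) (hr : r ≤ s) :
    ((2 * s ^ 2).descFactorial r : ℝ) * (2 * s ^ 2 - r * (r - 1)) ≤
      2 * s ^ 2 * (2 ^ r * (s ^ 2).descFactorial r) := by
  induction r with
  | zero => simp
  | succ r ih =>
    have ih := ih (by omega)
    have hrs : (r : ℝ) + 1 ≤ s := by exact_mod_cast hr
    have hr0 : (0 : ℝ) ≤ r := by positivity
    have hs2 : r ≤ s ^ 2 := by nlinarith
    have hss : (r : ℝ) ≤ s ^ 2 := by exact_mod_cast hs2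
    rw [Nat.descFactorial_succ, Nat.descFactorial_succ, Nat.cast_mul, Nat.cast_mul,
      Nat.cast_sub (by omega), Nat.cast_sub (by omega)]
    push_cast
    have key : (2 * (s : ℝ) ^ 2 - r) * (2 * s ^ 2 - (r + 1) * (r + 1 - 1)) ≤
        2 * (s ^ 2 - r) * (2 * s ^ 2 - r * (r - 1)) := by
      have h1 : ((r : ℝ) + 1) ^ 2 * r ≤ s ^ 2 * r := by gcongr
      nlinarith [mul_nonneg hr0 hr0, mul_nonneg hr0 (mul_nonneg hr0 hr0)]
    calc _ = ((2 * s ^ 2).descFactorial r : ℝ) *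
          ((2 * (s : ℝ) ^ 2 - r) * (2 * s ^ 2 - (r + 1) * (r + 1 - 1))) := by ring
      _ ≤ ((2 * s ^ 2).descFactorial r : ℝ) * (2 * (s ^ 2 - r) * (2 * s ^ 2 - r * (r - 1))) := by
          gcongr
      _ = 2 * (s ^ 2 - r) * (((2 * s ^ 2).descFactorial r : ℝ) * (2 * s ^ 2 - r * (r - 1))) := by
          ring
      _ ≤ 2 * (s ^ 2 - r) * (2 * s ^ 2 * (2 ^ r * (s ^ 2).descFactorial r)) :=
          mul_le_mul_of_nonneg_left ih (by linarith)
      _ = _ := by ring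

theorem choose_two_mul_sq_le {s : ℕ} (hs : 1 ≤ s) :
    (2 * s ^ 2).choose s ≤ 2 ^ (s + 1) * (s ^ 2).choose s := by
  have h := descFactorial_two_mul_sq_le hs le_rfl
  rw [Nat.descFactorial_eq_factorial_mul_choose, Nat.descFactorial_eq_factorial_mul_choose] at h
  push_cast at h
  have hf : (0 : ℝ) < s.factorial := by exact_mod_cast s.factorial_pos
  have hs1 : (1 : ℝ) ≤ s := by exact_mod_cast hs
  have h2 : ((2 * s ^ 2).choose s : ℝ) ≤ 2 ^ (s + 1) * (s ^ 2).choose s := by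
    refine le_of_mul_le_mul_left ?_ (by positivity : (0 : ℝ) < s.factorial * s ^ 2)
    have h3 : (0 : ℝ) ≤ s.factorial * (2 * s ^ 2).choose s := by positivity
    have h4 : (s : ℝ) ^ 2 ≤ 2 * s ^ 2 - s * (s - 1) := by nlinarith
    have h5 := mul_le_mul_of_nonneg_left h4 h3
    rw [pow_succ (2 : ℝ) s]
    linarith
  exact_mod_cast h2

/-! ### Evenly distributed halves -/

open Finset in
-- Greedy: each new element goes to a currently smallest fibre.
theorem exists_map_card_fiber_mul_card_le {α β : Type*} [DecidableEq α] [DecidableEq β]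
    (X : Finset α) {Y : Finset β} (hY : Y.Nonempty) :
    ∃ f : α → β, (∀ x, f x ∈ Y) ∧ ∀ y ∈ Y, #{x ∈ X | f x = y} * #Y ≤ #X + #Y := by
  induction X using Finset.induction_on with
  | empty =>
    obtain ⟨y, hy⟩ := hY
    exact ⟨fun _ => y, fun _ => hy, by simp⟩
  | insert a X ha ih =>
    obtain ⟨f, hf, hfX⟩ := ih
    obtain ⟨y₀, hy₀, hmin⟩ := exists_min_image Y (fun y => #{x ∈ X | f x = y}) hY
    have hsum : #X = ∑ y ∈ Y, #{x ∈ X | f x = y} :=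
      card_eq_sum_card_fiberwise fun x _ => hf x
    have hy₀X : #Y * #{x ∈ X | f x = y₀} ≤ #X := by
      rw [hsum, ← smul_eq_mul]
      exact card_nsmul_le_sum _ _ _ hmin
    refine ⟨Function.update f a y₀, fun x => ?_, fun y hy => ?_⟩
    · by_cases hx : x = a
      · subst hx; simpa using hy₀
      · simpa [hx] using hf x
    · have hX : {x ∈ X | Function.update f a y₀ x = y} = {x ∈ X | f x = y} := by
        refine filter_congr fun x hx => ?_
        rw [Function.update_of_ne (by rintro rfl; exact ha hx)]
      rw [filter_insert, hX, card_insert_of_notMem ha]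
      by_cases h : y₀ = y
      · subst h
        simp only [Function.update_self, if_true]
        rw [card_insert_of_notMem (by simp [ha])]
        nlinarith
      · simp only [Function.update_self, h, if_false]
        have := hfX y hy
        omega

open Finset in
theorem card_powersetCard_filter_superset_le {α : Type*} [DecidableEq α] {S N : Finset α}
    (hS : S ⊆ N) (k : ℕ) :
    #{H ∈ N.powersetCard k | S ⊆ H} ≤ (#N - #S).choose (k - #S) := by
  rw [← card_sdiff_of_subset hS, ← card_powersetCard]
  refine card_le_card_of_injOn (fun H => H \ S) ?_ ?_
  · intro H hH
    simp only [coe_filter, mem_powersetCard, Set.mem_ofPred_eq] at hH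
    simp only [mem_coe, mem_powersetCard]
    exact ⟨sdiff_subset_sdiff hH.1.1 le_rfl, by rw [card_sdiff_of_subset hH.2, hH.1.2]⟩
  · intro H hH H' hH' h
    simp only [coe_filter, mem_powersetCard, Set.mem_ofPred_eq] at hH hH'
    rw [← sdiff_union_of_subset hH.2, ← sdiff_union_of_subset hH'.2]
    exact congrArg (· ∪ S) h

open Finset in
theorem card_half_superset_le {α : Type*} [DecidableEq α] {S N : Finset α} (hS : S ⊆ N)
    (hS1 : 1 ≤ #S) {k : ℕ} (hk : 2 * k ≤ #N + 1) :
    (#S : ℝ) ^ 2 * 2 ^ #S * #{H ∈ N.powersetCard k | S ⊆ H} ≤ 8 * #N * (#N).choose k := by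
  rcases le_or_gt #S k with h | h
  · refine le_trans ?_ (sq_mul_two_pow_mul_choose_sub_le hk hS1 h)
    gcongr
    exact card_powersetCard_filter_superset_le hS k
  · have : {H ∈ N.powersetCard k | S ⊆ H} = ∅ := by
      refine filter_eq_empty_iff.2 fun H hH hSH => ?_
      have := card_le_card hSH
      rw [(mem_powersetCard.1 hH).2] at this
      omega
    rw [this]
    simp
    positivity

open Finset in
-- Complementation in `N` turns avoiding `S` into containing `S`. Halves may be rounded either way,
-- hence the slack of one in both hypotheses.
theorem card_half_disjoint_le {α : Type*} [DecidableEq α] {S N : Finset α} (hS : S ⊆ N)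
    (hS1 : 1 ≤ #S) {k : ℕ} (hkN : k ≤ #N) (hk : #N ≤ 2 * k + 1) :
    (#S : ℝ) ^ 2 * 2 ^ #S * #{H ∈ N.powersetCard k | Disjoint S H} ≤
      8 * #N * (#N).choose k := by
  rw [← Nat.choose_symm hkN]
  refine le_trans ?_ (card_half_superset_le (k := #N - k) hS hS1 (by omega))
  refine mul_le_mul_of_nonneg_left (Nat.cast_le.2 ?_) (by positivity)
  refine card_le_card_of_injOn (fun H => N \ H) ?_ ?_
  · intro H hH
    simp only [coe_filter, mem_powersetCard, Set.mem_ofPred_eq] at hH ⊢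
    exact ⟨⟨sdiff_subset, by rw [card_sdiff_of_subset hH.1.1, hH.1.2]⟩,
      subset_sdiff.2 ⟨hS, hH.2⟩⟩
  · intro H hH H' hH' h
    simp only [coe_filter, mem_powersetCard, Set.mem_ofPred_eq] at hH hH'
    have h' : N \ H = N \ H' := h
    rw [← Finset.sdiff_sdiff_eq_self hH.1.1, ← Finset.sdiff_sdiff_eq_self hH'.1.1, h']

open Finset in
/-- A choice, for each `v`, of half of the set `N v`, spread evenly over the vertices with the
same `N v`: any condition that few halves satisfy holds at few vertices. -/
theorem exists_balanced_halves {V α : Type*} [Fintype V] [DecidableEq V] [DecidableEq α]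
    (A : Finset α) (N : V → Finset α) (hN : ∀ v, N v ⊆ A) :
    ∃ H : V → Finset α, (∀ v, H v ∈ (N v).powersetCard (#(N v) / 2)) ∧
      ∀ (P : Finset α → Finset α → Prop) [∀ M, DecidablePred (P M)] (B : ℝ), 0 < B →
        (∀ M ⊆ A, B * #{L ∈ M.powersetCard (#M / 2) | P M L} ≤
          8 * #M * (#M).choose (#M / 2)) →
        (#{v | P (N v) (H v)} : ℝ) ≤ (∑ v, 8 * (#(N v) : ℝ)) / B + 4 ^ #A := by
  have hY (M : Finset α) : (M.powersetCard (#M / 2)).Nonempty :=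
    powersetCard_nonempty.2 (Nat.div_le_self _ _)
  choose f hf hfX using fun M : Finset α =>
    exists_map_card_fiber_mul_card_le ({v | N v = M} : Finset V) (hY M)
  refine ⟨fun v => f (N v) v, fun v => hf _ _, fun P _ B hB hP => ?_⟩
  -- Each bad half `L` of `M` is used at most (average + 1) times. The extra 1 costs `2^#A` per `M`,
  -- and `4^#A` over all `M ⊆ A`.
  have hfiber : ∀ M ∈ A.powerset,
      (#{v ∈ ({v | P (N v) (f (N v) v)} : Finset V) | N v = M} : ℝ) ≤
        #{v | N v = M} * (8 * #M / B) + 2 ^ #A := by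
    intro M hM
    rw [mem_powerset] at hM
    set Y := M.powersetCard (#M / 2)
    set h : ℝ := ((#M).choose (#M / 2) : ℝ) with hh
    have hYh : (#Y : ℝ) = h := by rw [card_powersetCard]
    have hpos : 0 < h := by rw [hh]; exact_mod_cast Nat.choose_pos (Nat.div_le_self _ _)
    have h1 : #{v ∈ ({v | P (N v) (f (N v) v)} : Finset V) | N v = M} =
        ∑ L ∈ Y with P M L, #{v ∈ ({v ∈ ({v | P (N v) (f (N v) v)} : Finset V) | N v = M}) |
          f M v = L} := by
      refine card_eq_sum_card_fiberwise fun v hv => ?_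
      simp only [coe_filter, mem_filter, mem_univ, true_and, Set.mem_ofPred_eq] at hv ⊢
      obtain ⟨hv, rfl⟩ := hv
      exact ⟨hf _ _, hv⟩
    have h2 : ∀ L ∈ Y, (#{v ∈ ({v | N v = M} : Finset V) | f M v = L} : ℝ) ≤
        #{v | N v = M} / h + 1 := by
      intro L hL
      rw [div_add_one hpos.ne', le_div_iff₀ hpos, ← hYh]
      exact_mod_cast hfX M L hL
    have h3 : (#{L ∈ Y | P M L} : ℝ) ≤ 2 ^ #A := by
      have : #{L ∈ Y | P M L} ≤ #A.powerset := card_le_card fun L hL => by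
        simp only [Y, mem_filter, mem_powersetCard] at hL
        exact mem_powerset.2 (hL.1.1.trans hM)
      rw [card_powerset] at this
      exact_mod_cast this
    have h4 : (#{L ∈ Y | P M L} : ℝ) / h ≤ 8 * #M / B := by
      rw [div_le_div_iff₀ hpos hB, mul_comm]
      exact hP M hM
    rw [h1, Nat.cast_sum]
    calc _ ≤ ∑ L ∈ Y with P M L, ((#{v | N v = M} : ℝ) / h + 1) := by
          refine sum_le_sum fun L hL => le_trans ?_ (h2 L (mem_filter.1 hL).1)
          refine Nat.cast_le.2 (card_le_card fun v hv => ?_)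
          simp only [mem_filter, mem_univ, true_and] at hv ⊢
          exact ⟨hv.1.2, hv.2⟩
      _ = #{v | N v = M} * (#{L ∈ Y | P M L} / h) + #{L ∈ Y | P M L} := by
          rw [sum_const, nsmul_eq_mul]; ring
      _ ≤ _ := by gcongr
  have htotal : #({v | P (N v) (f (N v) v)} : Finset V) =
      ∑ M ∈ A.powerset, #{v ∈ ({v | P (N v) (f (N v) v)} : Finset V) | N v = M} :=
    card_eq_sum_card_fiberwise fun v _ => by simpa using hN v
  rw [htotal, Nat.cast_sum]
  calc _ ≤ ∑ M ∈ A.powerset, ((#{v | N v = M} : ℝ) * (8 * #M / B) + 2 ^ #A) :=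
        sum_le_sum hfiber
    _ = (∑ M ∈ A.powerset, ∑ v with N v = M, 8 * (#(N v) : ℝ) / B) + 4 ^ #A := by
        rw [sum_add_distrib]
        congr 1
        · refine sum_congr rfl fun M _ => ?_
          rw [← nsmul_eq_mul, ← sum_const]
          refine sum_congr rfl fun v hv => ?_
          rw [(mem_filter.1 hv).2]
        · rw [sum_const, card_powerset, nsmul_eq_mul]
          push_cast
          rw [← mul_pow]
          norm_num
    _ = _ := by
        rw [sum_fiberwise_of_maps_to fun v _ => mem_powerset.2 (hN v), sum_div]

/-! ### Lower bound: colouring a graph with few edges -/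

open Finset in
/-- A graph with few edges has a two-coloring of its edges in which any `s` vertices of large
degree have few common neighbors joined to them in a single color. -/
theorem exists_coloring_card_mono_lt {V : Type*} [Fintype V] [DecidableEq V] (G : SimpleGraph V)
    [DecidableRel G.Adj] {s t : ℕ} (hs : 1 ≤ s)
    (ht : 4 * (s ^ 2 * 2 ^ s + 4 ^ (s ^ 2 * 2 ^ s)) ≤ t)
    (hG : (64 : ℝ) * #G.edgeFinset < s ^ 2 * 2 ^ s * t) :
    ∃ χ : G.edgeSet → Bool, ∀ (b : Bool) (S T : Finset V), #S = s → (∀ a ∈ S, t ≤ G.degree a) →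
      (∀ v ∈ T, ∀ a ∈ S, ∃ h : G.Adj v a, χ ⟨s(v, a), h⟩ = b) → #T < t := by
  classical
  set K := s ^ 2 * 2 ^ s with hK
  have hB : (0 : ℝ) < (s : ℝ) ^ 2 * 2 ^ s := by positivity
  have hKr : (K : ℝ) = (s : ℝ) ^ 2 * 2 ^ s := by rw [hK]; push_cast; rfl
  have ht0 : 0 < t := by
    have : 0 < 4 ^ K := by positivity
    omega
  have ht0r : (0 : ℝ) < t := by exact_mod_cast ht0
  set A : Finset V := {a | t ≤ G.degree a} with hA
  have hAK : #A ≤ K := by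
    have h1 : #A * t ≤ 2 * #G.edgeFinset := by
      rw [← G.sum_degrees_eq_twice_card_edges, ← smul_eq_mul]
      refine (card_nsmul_le_sum A (fun v => G.degree v) t fun a ha => (mem_filter.1 ha).2).trans ?_
      exact sum_le_sum_of_subset (subset_univ _)
    have h2 : (#A : ℝ) * t ≤ 2 * #G.edgeFinset := by exact_mod_cast h1
    have h3 : (#A : ℝ) ≤ K := by
      refine le_of_mul_le_mul_right ?_ ht0r
      rw [hKr]
      linarith [Nat.cast_nonneg (α := ℝ) #G.edgeFinset]
    exact_mod_cast h3
  obtain ⟨H, hH, hbal⟩ := exists_balanced_halves A (fun v : V => {a ∈ A | G.Adj v a})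
    fun v => filter_subset _ _
  have hHA (v : V) : H v ⊆ A := fun a ha =>
    (mem_filter.1 ((mem_powersetCard.1 (hH v)).1 ha)).1
  have hdeg : ∑ v, 8 * (#{a ∈ A | G.Adj v a} : ℝ) ≤ 16 * #G.edgeFinset := by
    have h1 : ∑ v, #{a ∈ A | G.Adj v a} ≤ 2 * #G.edgeFinset := by
      rw [← G.sum_degrees_eq_twice_card_edges]
      refine sum_le_sum fun v _ => ?_
      rw [← G.card_neighborFinset_eq_degree]
      exact card_le_card fun a ha => by simpa using (mem_filter.1 ha).2
    have h2 : (∑ v, #{a ∈ A | G.Adj v a} : ℝ) ≤ 2 * #G.edgeFinset := by exact_mod_cast h1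
    rw [← mul_sum]
    linarith
  have hfew (P : Finset V → Finset V → Prop) [∀ M, DecidablePred (P M)]
      (hP : ∀ M ⊆ A, (s : ℝ) ^ 2 * 2 ^ s * #{L ∈ M.powersetCard (#M / 2) | P M L} ≤
          8 * #M * (#M).choose (#M / 2)) :
      -- The budget is `t/4` for the average term and `t/4` for `4^#A + #A`; the summand `#A` pays
      -- for vertices of `T` inside `A`.
      #{v | P {a ∈ A | G.Adj v a} (H v)} + #A < t := by
    have h1 := hbal P _ hB hP
    have h2 : (∑ v, 8 * (#{a ∈ A | G.Adj v a} : ℝ)) / ((s : ℝ) ^ 2 * 2 ^ s) ≤ t / 4 := by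
      rw [div_le_iff₀ hB]
      linarith
    have h3 : (4 : ℝ) ^ #A ≤ 4 ^ K := pow_le_pow_right₀ (by norm_num) hAK
    have h4 : (4 : ℝ) * (K + 4 ^ K) ≤ t := by exact_mod_cast ht
    have h5 : (#A : ℝ) ≤ K := by exact_mod_cast hAK
    have : (#{v | P {a ∈ A | G.Adj v a} (H v)} : ℝ) + #A < t := by linarith
    exact_mod_cast this
  -- Edges inside `A` or inside its complement become blue; their colour is irrelevant.
  refine ⟨fun e => decide (∃ v ∉ A, ∃ a ∈ H v, (e : Sym2 V) = s(v, a)), ?_⟩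
  have hχ {v a : V} (hv : v ∉ A) (ha : a ∈ A) :
      (∃ v' ∉ A, ∃ a' ∈ H v', s(v, a) = s(v', a')) ↔ a ∈ H v := by
    refine ⟨?_, fun h => ⟨v, hv, a, h, rfl⟩⟩
    rintro ⟨v', hv', a', ha', h⟩
    rcases Sym2.eq_iff.1 h with ⟨rfl, rfl⟩ | ⟨rfl, rfl⟩
    · exact ha'
    · exact absurd (hHA _ ha') hv
  intro b S T hS hSA hT
  have hSA : S ⊆ A := fun a ha => mem_filter.2 ⟨mem_univ _, hSA a ha⟩
  have hTA : #T ≤ #(T \ A) + #A := by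
    have := le_card_sdiff A T
    omega
  refine hTA.trans_lt ?_
  cases b with
  | true =>
    refine lt_of_le_of_lt ?_ (hfew (fun M L => S ⊆ M ∧ S ⊆ L) fun M _ => ?_)
    · gcongr
      intro v hv
      obtain ⟨hvT, hvA⟩ := mem_sdiff.1 hv
      refine mem_filter.2 ⟨mem_univ _, fun a ha => ?_, fun a ha => ?_⟩
      · exact mem_filter.2 ⟨hSA ha, (hT v hvT a ha).1⟩
      · obtain ⟨h, hc⟩ := hT v hvT a ha
        exact (hχ hvA (hSA ha)).1 (of_decide_eq_true hc)
    · by_cases hM : S ⊆ M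
      · simp only [hM, true_and]
        rw [← hS]
        exact card_half_superset_le hM (by omega) (by omega)
      · simp [hM]
        positivity
  | false =>
    refine lt_of_le_of_lt ?_ (hfew (fun M L => S ⊆ M ∧ Disjoint S L) fun M _ => ?_)
    · gcongr
      intro v hv
      obtain ⟨hvT, hvA⟩ := mem_sdiff.1 hv
      refine mem_filter.2 ⟨mem_univ _, fun a ha => ?_, disjoint_left.2 fun a ha haH => ?_⟩
      · exact mem_filter.2 ⟨hSA ha, (hT v hvT a ha).1⟩
      · obtain ⟨h, hc⟩ := hT v hvT a ha
        exact of_decide_eq_false hc ((hχ hvA (hSA ha)).2 haH)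
    · by_cases hM : S ⊆ M
      · simp only [hM, true_and]
        rw [← hS]
        exact card_half_disjoint_le hM (by omega) (by omega) (by omega)
      · simp [hM]
        positivity

namespace EdgeOrderedGraph

open Finset in
theorem le_ncard_edgeSet_of_arrows {W : Type*} [Fintype W] {F : EdgeOrderedGraph W} {s t : ℕ}
    (hs : 1 ≤ s) (ht : 4 * (s ^ 2 * 2 ^ s + 4 ^ (s ^ 2 * 2 ^ s)) ≤ t)
    (hF : F.Arrows (completeBipartite s t) (completeBipartite s t)) :
    (s : ℝ) ^ 2 * 2 ^ s * t ≤ 64 * F.graph.edgeSet.ncard := by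
  classical
  by_contra! hlt
  rw [← SimpleGraph.coe_edgeFinset, Set.ncard_coe_finset] at hlt
  obtain ⟨χ, hχ⟩ := exists_coloring_card_mono_lt F.graph hs ht hlt
  obtain ⟨b, φ, -, hφ⟩ : ∃ b, F.HasCopy χ b (completeBipartite s t) :=
    (hF χ).elim (fun h => ⟨_, h⟩) fun h => ⟨_, h⟩
  have hadj (i : Fin s) (j : Fin t) :
      (completeBipartite s t).graph.Adj (Sum.inr j) (Sum.inl i) := by
    simp [completeBipartite]
  have hinl : Function.Injective fun i : Fin s => φ (Sum.inl i) :=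
    φ.injective.comp Sum.inl_injective
  have hinr : Function.Injective fun j : Fin t => φ (Sum.inr j) :=
    φ.injective.comp Sum.inr_injective
  refine (hχ b (univ.image fun i : Fin s => φ (Sum.inl i))
    (univ.image fun j : Fin t => φ (Sum.inr j)) ?_ ?_ ?_).ne ?_
  · rw [card_image_of_injective _ hinl, card_fin]
  · simp only [mem_image, mem_univ, true_and, forall_exists_index, forall_apply_eq_imp_iff]
    intro i
    rw [← F.graph.card_neighborFinset_eq_degree]
    calc t = #(univ.image fun j : Fin t => φ (Sum.inr j)) := by
          rw [card_image_of_injective _ hinr, card_fin]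
      _ ≤ _ := card_le_card fun v hv => by
          obtain ⟨j, -, rfl⟩ := mem_image.1 hv
          rw [SimpleGraph.mem_neighborFinset]
          exact φ.toHom.map_adj (hadj i j).symm
  · simp only [mem_image, mem_univ, true_and, forall_exists_index, forall_apply_eq_imp_iff]
    intro j i
    exact ⟨φ.toHom.map_adj (hadj i j), hφ ⟨s(Sum.inr j, Sum.inl i), hadj i j⟩⟩
  · rw [card_image_of_injective _ hinr, card_fin]

end EdgeOrderedGraph

/-! ### Upper bound: a monochromatic rectangle -/

open Finset in
theorem exists_mono_rectangle {α β : Type*} [Fintype α] [Fintype β] {s t : ℕ} (hs : 1 ≤ s)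
    (hα : Fintype.card α = 2 * s ^ 2) (hβ : Fintype.card β = 2 ^ (s + 2) * t)
    (χ : α → β → Bool) :
    ∃ (c : Bool) (S : Finset (α)) (T : Finset (β)),
      #S = s ∧ #T = t ∧ ∀ u ∈ S, ∀ v ∈ T, χ u v = c := by
  classical
  set Q : Finset (Bool × Finset (α)) := univ ×ˢ univ.powersetCard s with hQ
  have hcard : #Q = 2 * (2 * s ^ 2).choose s := by simp [hQ, hα]
  suffices h : ∃ p ∈ Q, t ≤ #{v | ∀ u ∈ p.2, χ u v = p.1} by
    obtain ⟨p, hp, ht⟩ := h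
    obtain ⟨T, hT, hTt⟩ := exists_subset_card_eq ht
    refine ⟨p.1, p.2, T, ?_, hTt, fun u hu v hv => (mem_filter.1 (hT hv)).2 u hu⟩
    exact (mem_powersetCard.1 (mem_product.1 hp).2).2
  by_contra! hlt
  -- Double counting of right vertices against pairs (colour, `s`-set): the majority colour at `v`
  -- occurs on `s^2` of the `2s^2` left vertices.
  have hv (v : β) :
      (s ^ 2).choose s ≤ #{p ∈ Q | ∀ u ∈ p.2, χ u v = p.1} := by
    obtain ⟨c, hc⟩ : ∃ c, s ^ 2 ≤ #{u | χ u v = c} := by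
      have h := card_filter_add_card_filter_not (s := (univ : Finset (α)))
        (fun u => χ u v = true)
      simp only [Bool.not_eq_true, card_univ, hα] at h
      by_contra! hc
      have h1 := hc true
      have h2 := hc false
      omega
    calc (s ^ 2).choose s ≤ #(({u | χ u v = c} : Finset _).powersetCard s) := by
          rw [card_powersetCard]; exact Nat.choose_le_choose s hc
      _ ≤ _ := card_le_card_of_injOn (fun S => (c, S)) (fun S hS => by
          simp only [mem_coe, mem_powersetCard] at hS
          simp only [hQ, coe_filter, Set.mem_ofPred_eq, mem_product, mem_univ, true_and,
            mem_powersetCard, subset_univ]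
          exact ⟨hS.2, fun u hu => (mem_filter.1 (hS.1 hu)).2⟩)
          fun S _ S' _ h => (Prod.mk.inj h).2
  have hne : Q.Nonempty := by
    rw [← card_pos, hcard]
    have := Nat.choose_pos (show s ≤ 2 * s ^ 2 by nlinarith)
    omega
  have h1 : ∑ p ∈ Q, #{v | ∀ u ∈ p.2, χ u v = p.1} =
      ∑ v, #{p ∈ Q | ∀ u ∈ p.2, χ u v = p.1} :=
    sum_card_bipartiteAbove_eq_sum_card_bipartiteBelow
      (fun (p : Bool × Finset α) v => ∀ u ∈ p.2, χ u v = p.1)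
  have h2 : ∑ p ∈ Q, #{v | ∀ u ∈ p.2, χ u v = p.1} < ∑ _p ∈ Q, t :=
    sum_lt_sum_of_nonempty hne hlt
  have h3 : ∑ _v : β, (s ^ 2).choose s ≤
      ∑ v, #{p ∈ Q | ∀ u ∈ p.2, χ u v = p.1} := sum_le_sum fun v _ => hv v
  rw [sum_const, card_univ, hβ, smul_eq_mul] at h3
  rw [sum_const, hcard, smul_eq_mul] at h2
  have h4 : 2 * (2 * s ^ 2).choose s * t ≤ 2 ^ (s + 2) * t * (s ^ 2).choose s := by
    calc _ ≤ 2 * (2 ^ (s + 1) * (s ^ 2).choose s) * t := by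
          gcongr; exact choose_two_mul_sq_le hs
      _ = _ := by ring
  exact absurd (h3.trans_lt (h1 ▸ h2)) h4.not_gt

/-! ### Lexicographic copies and transport to `Fin n` -/

namespace EdgeOrderedGraph

theorem bipartiteLexLT_iff {s t : ℕ} {e f : (completeBipartiteGraph (Fin s) (Fin t)).edgeSet}
    {i k : Fin s} {j l : Fin t} (he : (e : Sym2 (Fin s ⊕ Fin t)) = s(Sum.inl i, Sum.inr j))
    (hf : (f : Sym2 (Fin s ⊕ Fin t)) = s(Sum.inl k, Sum.inr l)) :
    bipartiteLexLT s t e f ↔ i < k ∨ (i = k ∧ j < l) := by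
  refine ⟨?_, fun h => ⟨i, k, j, l, he, hf, h⟩⟩
  rintro ⟨i', k', j', l', he', hf', h⟩
  rw [he] at he'
  rw [hf] at hf'
  simp only [Sym2.eq_iff, Sum.inl.injEq, Sum.inr.injEq, reduceCtorEq, and_self, or_false]
    at he' hf'
  obtain ⟨rfl, rfl⟩ := he'
  obtain ⟨rfl, rfl⟩ := hf'
  exact h

/-- The copy of a complete bipartite graph in a larger one given by injections of the parts. -/
def completeBipartiteCopy {s t a b : ℕ} (f : Fin s ↪o Fin a) (g : Fin t ↪o Fin b) :
    SimpleGraph.Copy (completeBipartite s t).graph (completeBipartite a b).graph where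
  toHom :=
    { toFun := Sum.map f g
      map_rel' := by
        rintro (x | x) (y | y) h <;> simp_all [completeBipartite] }
  injective' := f.injective.sumMap g.injective

theorem coe_mapEdgeSet_completeBipartiteCopy {s t a b : ℕ} (f : Fin s ↪o Fin a)
    (g : Fin t ↪o Fin b) {e : (completeBipartite s t).graph.edgeSet} {i : Fin s} {j : Fin t}
    (he : (e : Sym2 (Fin s ⊕ Fin t)) = s(Sum.inl i, Sum.inr j)) :
    ((completeBipartiteCopy f g).mapEdgeSet e : Sym2 (Fin a ⊕ Fin b)) =
      s(Sum.inl (f i), Sum.inr (g j)) := by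
  change Sym2.map (Sum.map f g) (e : Sym2 (Fin s ⊕ Fin t)) = _
  rw [he]
  rfl

theorem arrows_completeBipartite {s t : ℕ} (hs : 1 ≤ s) :
    (completeBipartite (2 * s ^ 2) (2 ^ (s + 2) * t)).Arrows
      (completeBipartite s t) (completeBipartite s t) := by
  intro χ
  obtain ⟨c, S, T, hS, hT, hc⟩ := exists_mono_rectangle hs (t := t)
    (Fintype.card_fin _) (Fintype.card_fin _)
    fun u v => χ ⟨s(Sum.inl u, Sum.inr v), by simp [completeBipartite]⟩
  have hcopy : HasCopy _ χ c (completeBipartite s t) := by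
    refine ⟨completeBipartiteCopy (S.orderEmbOfFin hS) (T.orderEmbOfFin hT), fun e e' => ?_,
      fun e => ?_⟩
    · obtain ⟨i, j, he⟩ := exists_eq_of_mem_edgeSet_bipartite e
      obtain ⟨k, l, he'⟩ := exists_eq_of_mem_edgeSet_bipartite e'
      refine (bipartiteLexLT_iff he he').trans (Iff.trans ?_ (bipartiteLexLT_iff
        (coe_mapEdgeSet_completeBipartiteCopy _ _ he)
        (coe_mapEdgeSet_completeBipartiteCopy _ _ he')).symm)
      simp
    · obtain ⟨i, j, he⟩ := exists_eq_of_mem_edgeSet_bipartite e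
      rw [← hc _ (S.orderEmbOfFin_mem hS i) _ (T.orderEmbOfFin_mem hT j)]
      exact congrArg χ (Subtype.ext (coe_mapEdgeSet_completeBipartiteCopy _ _ he))
  cases c
  · exact Or.inr hcopy
  · exact Or.inl hcopy

/-- Transport of an edge-ordered graph along a graph isomorphism. -/
def transport {V W : Type*} (F : EdgeOrderedGraph V) {G : SimpleGraph W} (φ : F.graph ≃g G) :
    EdgeOrderedGraph W where
  graph := G
  lt e f := F.lt (φ.symm.mapEdgeSet e) (φ.symm.mapEdgeSet f)
  isStrictTotalOrder :=
    haveI := F.isStrictTotalOrder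
    (RelEmbedding.preimage φ.symm.mapEdgeSet.toEmbedding F.lt).isStrictTotalOrder

theorem HasCopy.transport {U V W : Type*} {F : EdgeOrderedGraph V} {G : SimpleGraph W}
    (φ : F.graph ≃g G) {χ : G.edgeSet → Bool} {b : Bool} {H : EdgeOrderedGraph U}
    (h : F.HasCopy (χ ∘ φ.mapEdgeSet) b H) : (F.transport φ).HasCopy χ b H := by
  obtain ⟨ψ, hlt, hb⟩ := h
  have hψ (e : H.graph.edgeSet) :
      (φ.toCopy.comp ψ).mapEdgeSet e = φ.mapEdgeSet (ψ.mapEdgeSet e) := by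
    obtain ⟨e, he⟩ := e
    induction e using Sym2.ind with
    | _ x y => rfl
  refine ⟨φ.toCopy.comp ψ, fun e f => (hlt e f).trans ?_, fun e => ?_⟩
  · change _ ↔ F.lt (φ.mapEdgeSet.symm ((φ.toCopy.comp ψ).mapEdgeSet e))
      (φ.mapEdgeSet.symm ((φ.toCopy.comp ψ).mapEdgeSet f))
    rw [hψ, hψ, Equiv.symm_apply_apply, Equiv.symm_apply_apply]
  · rw [← hb e]
    exact congrArg χ (hψ e)

theorem Arrows.exists_fin {U U' V : Type*} [Fintype V] {F : EdgeOrderedGraph V}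
    {G : EdgeOrderedGraph U} {H : EdgeOrderedGraph U'} (h : F.Arrows G H) :
    ∃ (n : ℕ) (F' : EdgeOrderedGraph (Fin n)),
      F'.graph.edgeSet.ncard = F.graph.edgeSet.ncard ∧ F'.Arrows G H := by
  let φ := SimpleGraph.Iso.map (Fintype.equivFin V) F.graph
  refine ⟨_, F.transport φ, ?_, fun χ => ?_⟩
  · exact (Set.ncard_congr' φ.mapEdgeSet).symm
  · exact (h (χ ∘ φ.mapEdgeSet)).imp (HasCopy.transport φ) (HasCopy.transport φ)

theorem ncard_edgeSet_completeBipartite_le (a b : ℕ) :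
    (completeBipartite a b).graph.edgeSet.ncard ≤ a * b := by
  have hsub : (completeBipartite a b).graph.edgeSet ⊆
      Set.range fun p : Fin a × Fin b => s(Sum.inl p.1, Sum.inr p.2) := fun e he => by
    obtain ⟨i, j, h⟩ := exists_eq_of_mem_edgeSet_bipartite ⟨e, he⟩
    exact ⟨(i, j), h.symm⟩
  refine (Set.ncard_le_ncard hsub (Set.toFinite _)).trans ?_
  rw [← Set.image_univ]
  refine (Set.ncard_image_le Set.finite_univ).trans ?_
  simp [Set.ncard_univ]

end EdgeOrderedGraph

/-! ### The two bounds combined -/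

theorem corollary3p11 :
    ∃ c C : ℝ, 0 < c ∧ 0 < C ∧
      ∀ s : ℕ, 1 ≤ s → ∃ t₀ : ℕ, ∀ t : ℕ, t₀ ≤ t →
        c * ((s : ℝ) ^ 2 * 2 ^ s * (t : ℝ)) ≤
            ((EdgeOrderedGraph.completeBipartite s t).sizeRamsey
              (EdgeOrderedGraph.completeBipartite s t) : ℝ) ∧
          ((EdgeOrderedGraph.completeBipartite s t).sizeRamsey
              (EdgeOrderedGraph.completeBipartite s t) : ℝ) ≤
            C * ((s : ℝ) ^ 2 * 2 ^ s * (t : ℝ)) := by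
  refine ⟨1 / 64, 8, by norm_num, by norm_num, fun s hs =>
    ⟨4 * (s ^ 2 * 2 ^ s + 4 ^ (s ^ 2 * 2 ^ s)), fun t ht => ?_⟩⟩
  obtain ⟨n, F, hFcard, hF⟩ := (EdgeOrderedGraph.arrows_completeBipartite (t := t) hs).exists_fin
  constructor
  -- Nonemptiness, from the upper-bound host, makes the infimum attained; `sInf ∅` would be `0`.
  · have hne : {m : ℕ | ∃ (n : ℕ) (F : EdgeOrderedGraph (Fin n)), F.graph.edgeSet.ncard = m ∧
        F.Arrows (EdgeOrderedGraph.completeBipartite s t)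
          (EdgeOrderedGraph.completeBipartite s t)}.Nonempty := ⟨_, n, F, rfl, hF⟩
    obtain ⟨n', F', hF'card, hF'⟩ := Nat.sInf_mem hne
    have h := EdgeOrderedGraph.le_ncard_edgeSet_of_arrows hs ht hF'
    rw [hF'card] at h
    unfold EdgeOrderedGraph.sizeRamsey
    linarith
  · have h1 : (EdgeOrderedGraph.completeBipartite s t).sizeRamsey
        (EdgeOrderedGraph.completeBipartite s t) ≤ F.graph.edgeSet.ncard :=
      Nat.sInf_le ⟨n, F, rfl, hF⟩
    have h2 := (h1.trans_eq hFcard).trans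
      (EdgeOrderedGraph.ncard_edgeSet_completeBipartite_le _ _)
    calc _ ≤ ((2 * s ^ 2 * (2 ^ (s + 2) * t) : ℕ) : ℝ) := by exact_mod_cast h2
      _ = _ := by push_cast; ring
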